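/- Let $\mathcal X,\mathcal Z$ be complex Hilbert spaces, $E:\mathcal X\to\mathcal Z$ a bounded linear operator, $A:D(A)\subset\mathcal X\to\mathcal Z$ a densely defined closed linear operator, and $\alpha\in\mathbb R$. For a linear operator $B:D(B)\subset\mathcal X\to\mathcal Z$ let $\varrho(E,B)$ be the set of all $s\in\mathbb C$ for which $sE-B:D(B)\to\mathcal Z$ has an inverse $(sE-B)^{-1}$ that is a bounded operator from $\mathcal Z$ to $\mathcal X$, and for $s\in\varrho(E,B)$ put $$R^E(s,B)=(sE-B)^{-1}E,\qquad L^E(s,B)=E(sE-B)^{-1}.$$ Suppose that $A-\alpha E$ (with domain $D(A)$) is $E$-radial with constant $K>0$; that is, every real $s>0$ belongs to $\varrho(E,A-\alpha E)$, and $$\|R^E(s,A-\alpha E)^n\|\le \frac{K}{s^n},\qquad \|L^E(s,A-\alpha E)^n\|\le\frac{K}{s^n}\qquad\text{for all integers } n\ge 1 \text{ and all real } s>0.$$ Suppose also that $\operatorname{ran}E$ is closed in $\mathcal Z$. Then $\varrho(E,A)\neq\emptyset$. For every $\beta\in\varrho(E,A)$ put $$\mathcal X^1=\overline{\operatorname{ran}R^E(\beta,A)},\qquad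 \mathcal Z^1=\overline{\operatorname{ran}L^E(\beta,A)},$$ and let $E_1=E|_{\mathcal X^1}$ and $A_1=A|_{D(A)\cap\mathcal X^1}$. Then $E_1$ maps $\mathcal X^1$ into $\mathcal Z^1$ and is boundedly invertible as an operator $\mathcal X^1\to\mathcal Z^1$, $A_1$ maps $D(A)\cap\mathcal X^1$ into $\mathcal Z^1$, and the operator $E_1^{-1}A_1$ with domain $D(A)\cap\mathcal X^1$ is the infinitesimal generator of a $C_0$-semigroup $(S(t))_{t\ge0}$ on $\mathcal X^1$ satisfying $$\|S(t)\|\le K e^{\alpha t}\qquad\text{for all } t\ge 0.$$ -/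

import Mathlib

open scoped NNReal Topology
open Filter

namespace OperatorPencil

section Pencil

variable {X Z : Type*} [NormedAddCommGroup X] [InnerProductSpace ℂ X]
  [NormedAddCommGroup Z] [InnerProductSpace ℂ Z]

/-- The operator `s E - A : D(A) ⊆ X → Z`. -/
def pencil (E : X →L[ℂ] Z) (A : X →ₗ.[ℂ] Z) (s : ℂ) : X →ₗ.[ℂ] Z :=
  ((s • E : X →L[ℂ] Z) : X →ₗ[ℂ] Z) +ᵥ (-A)

/-- The operator `A - c E : D(A) ⊆ X → Z`. -/
def shift (E : X →L[ℂ] Z) (A : X →ₗ.[ℂ] Z) (c : ℂ) : X →ₗ.[ℂ] Z :=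
  ((-(c • E) : X →L[ℂ] Z) : X →ₗ[ℂ] Z) +ᵥ A

/-- The bounded everywhere defined operator `R : Z → X` is a two-sided inverse of the (possibly
unbounded) operator `T : D(T) ⊆ X → Z`. -/
def IsBoundedInverse (T : X →ₗ.[ℂ] Z) (R : Z →L[ℂ] X) : Prop :=
  (∀ z : Z, ∃ h : R z ∈ T.domain, T ⟨R z, h⟩ = z) ∧ ∀ x : T.domain, R (T x) = x

/-- The resolvent set `ϱ(E, A)`: all `s ∈ ℂ` such that `(s E - A)⁻¹` exists as a bounded operator
from `Z` to `X`. -/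
def resolventSet (E : X →L[ℂ] Z) (A : X →ₗ.[ℂ] Z) : Set ℂ :=
  {s | ∃ R : Z →L[ℂ] X, IsBoundedInverse (pencil E A s) R}

open Classical in
/-- The operator `(s E - A)⁻¹` for `s ∈ ϱ(E, A)` (and `0` otherwise). -/
noncomputable def resolvent (E : X →L[ℂ] Z) (A : X →ₗ.[ℂ] Z) (s : ℂ) : Z →L[ℂ] X :=
  if h : ∃ R : Z →L[ℂ] X, IsBoundedInverse (pencil E A s) R then h.choose else 0

/-- The right `E`-resolvent `R^E(s, A) = (s E - A)⁻¹ E`. -/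
noncomputable def rightResolvent (E : X →L[ℂ] Z) (A : X →ₗ.[ℂ] Z) (s : ℂ) : X →L[ℂ] X :=
  (resolvent E A s).comp E

/-- The left `E`-resolvent `L^E(s, A) = E (s E - A)⁻¹`. -/
noncomputable def leftResolvent (E : X →L[ℂ] Z) (A : X →ₗ.[ℂ] Z) (s : ℂ) : Z →L[ℂ] Z :=
  E.comp (resolvent E A s)

/-- `A` is `E`-radial with constant `K`. The operator `A` is `E`-radial if this holds for
some `K`. -/
structure IsRadialWith (E : X →L[ℂ] Z) (A : X →ₗ.[ℂ] Z) (K : ℝ) : Prop where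
  pos : 0 < K
  mem_resolventSet : ∀ s : ℝ, 0 < s → (s : ℂ) ∈ resolventSet E A
  norm_rightResolvent_pow_le : ∀ n : ℕ, 1 ≤ n → ∀ s : ℝ, 0 < s →
    ‖rightResolvent E A (s : ℂ) ^ n‖ ≤ K / s ^ n
  norm_leftResolvent_pow_le : ∀ n : ℕ, 1 ≤ n → ∀ s : ℝ, 0 < s →
    ‖leftResolvent E A (s : ℂ) ^ n‖ ≤ K / s ^ n

/-- The space `X¹`, the closure of the range of `R^E(β, A)`, where `β ∈ ϱ(E, A)`. -/
noncomputable def X1 (E : X →L[ℂ] Z) (A : X →ₗ.[ℂ] Z) (β : ℂ) : Submodule ℂ X :=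
  (LinearMap.range (rightResolvent E A β : X →ₗ[ℂ] X)).topologicalClosure

/-- The space `Z¹`, the closure of the range of `L^E(β, A)`, where `β ∈ ϱ(E, A)`. -/
noncomputable def Z1 (E : X →L[ℂ] Z) (A : X →ₗ.[ℂ] Z) (β : ℂ) : Submodule ℂ Z :=
  (LinearMap.range (leftResolvent E A β : Z →ₗ[ℂ] Z)).topologicalClosure

theorem map_mem_Z1 (E : X →L[ℂ] Z) (A : X →ₗ.[ℂ] Z) (β : ℂ) (x : X1 E A β) :
    E (x : X) ∈ Z1 E A β := by
  have hm : Set.MapsTo E (LinearMap.range (rightResolvent E A β : X →ₗ[ℂ] X) : Set X)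
      (LinearMap.range (leftResolvent E A β : Z →ₗ[ℂ] Z) : Set Z) := by
    rintro _ ⟨y, rfl⟩
    exact ⟨E y, rfl⟩
  exact map_mem_closure E.continuous x.2 hm

/-- The restriction `E₁ : X¹ → Z¹` of `E`. -/
noncomputable def E1 (E : X →L[ℂ] Z) (A : X →ₗ.[ℂ] Z) (β : ℂ) : X1 E A β →L[ℂ] Z1 E A β :=
  (E.comp (X1 E A β).subtypeL).codRestrict (Z1 E A β) (map_mem_Z1 E A β)

/-- The restriction `A₁ : D(A) ∩ X¹ → Z¹` of `A`, given that `A` maps `D(A) ∩ X¹` into `Z¹`. -/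
noncomputable def A1 (E : X →L[ℂ] Z) (A : X →ₗ.[ℂ] Z) (β : ℂ)
    (h : ∀ x : A.domain, (x : X) ∈ X1 E A β → A x ∈ Z1 E A β) : X1 E A β →ₗ.[ℂ] Z1 E A β where
  domain := A.domain.comap (X1 E A β).subtype
  toFun :=
    { toFun := fun x => ⟨A ⟨((x : X1 E A β) : X), x.2⟩, h _ (x : X1 E A β).2⟩
      map_add' := fun x y => Subtype.ext (A.map_add ⟨((x : X1 E A β) : X), x.2⟩
        ⟨((y : X1 E A β) : X), y.2⟩)
      map_smul' := fun c x => Subtype.ext (A.map_smul c ⟨((x : X1 E A β) : X), x.2⟩) }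

end Pencil

section Semigroup

variable {Y : Type*} [NormedAddCommGroup Y] [NormedSpace ℂ Y]

/-- `(S(t))_{t ≥ 0}` is a strongly continuous semigroup (a `C₀`-semigroup) on `Y`. -/
structure IsC0Semigroup (S : ℝ≥0 → Y →L[ℂ] Y) : Prop where
  map_zero : S 0 = ContinuousLinearMap.id ℂ Y
  map_add : ∀ s t : ℝ≥0, S (s + t) = (S s).comp (S t)
  tendsto_zero : ∀ y : Y, Tendsto (fun t : ℝ≥0 => S t y) (𝓝[>] 0) (𝓝 y)

/-- `B` is the infinitesimal generator of `S`: its domain consists of all `y` for which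
`(S(t) y - y) / t` converges as `t ↓ 0`, and `B y` is that limit. -/
def IsGenerator (B : Y →ₗ.[ℂ] Y) (S : ℝ≥0 → Y →L[ℂ] Y) : Prop :=
  ∀ y z : Y, (y, z) ∈ B.graph ↔
    Tendsto (fun t : ℝ≥0 => ((t : ℝ) : ℂ)⁻¹ • (S t y - y)) (𝓝[>] 0) (𝓝 z)

end Semigroup

end OperatorPencil

/-! For `s > 0` the right and left `E`-resolvents at `s + α` are families of bounded operators that
satisfy the resolvent identity and the Hille–Yosida bounds, but are not injective in general. Such a
pseudo-resolvent has a kernel and a range that do not depend on `s`, and `s R(s) y → y` on the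
closure of the range. On a Hilbert space the adjoint family is again of this kind, so the space
splits as kernel plus closed range (`exists_ker_add_closure_range`).

The splitting of `X` and the closedness of `ran E` make `E₁` a bijection `X¹ → Z¹`
(`isInvertible_E1`). The splitting of `Z` and the closedness of `A` show that `A` maps `D(A) ∩ X¹`
into `Z¹` (`apply_mem_Z1`).

On `X¹` the right resolvents have dense range, so Yosida's construction yields a semigroup bounded
by `K` whose generator `B` satisfies `R(1) = (1 - B)⁻¹` (`exists_semigroup`). Multiplication by
`e^{αt}` turns the generator into `B + α`, and unwinding the resolvent at `1 + α` identifies this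
with `E₁⁻¹A₁`. -/

namespace OperatorPencil

/-! ### Pseudo-resolvents and their strong limits -/

section Generation

open NormedSpace

variable {Y : Type*} [NormedAddCommGroup Y] [NormedSpace ℂ Y]

/-- A family of bounded operators indexed by `s > 0` which satisfies the resolvent identity and the
Hille–Yosida bounds with constant `K`. -/
structure IsPseudoResolvent (R : ℝ → Y →L[ℂ] Y) (K : ℝ) : Prop where
  pos : 0 < K
  sub_eq : ∀ s t : ℝ, 0 < s → 0 < t → R s - R t = ((t - s : ℝ) : ℂ) • (R s * R t)
  norm_pow_le : ∀ n : ℕ, 1 ≤ n → ∀ s : ℝ, 0 < s → ‖R s ^ n‖ ≤ K / s ^ n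

/-- A three-epsilon argument. It reduces strong convergence of a uniformly bounded family to a check
on a dense set; the Cauchy version below plays the same role when the limit is not yet known. -/
theorem isClosed_setOf_tendsto_self {ι : Type*} {l : Filter ι} (T : ι → Y →L[ℂ] Y) {C : ℝ}
    (hT : ∀ᶠ i in l, ‖T i‖ ≤ C) : IsClosed {y | Tendsto (fun i => T i y) l (𝓝 y)} := by
  rcases l.eq_or_neBot with rfl | hl
  · simp
  have hC : 0 ≤ C := by
    obtain ⟨i, hi⟩ := hT.exists
    exact (norm_nonneg _).trans hi
  refine isClosed_of_closure_subset fun y hy => ?_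
  rw [Set.mem_ofPred_eq, Metric.tendsto_nhds]
  intro ε hε
  obtain ⟨x, hx, hxy⟩ := Metric.mem_closure_iff.1 hy (ε / (2 * (C + 1))) (by positivity)
  filter_upwards [hT, Metric.tendsto_nhds.1 hx (ε / 2) (by positivity)] with i hi hix
  have h1 : ‖T i (y - x)‖ ≤ C * ‖y - x‖ := (T i).le_of_opNorm_le hi _
  rw [dist_eq_norm] at hix hxy ⊢
  have h2 : T i y - y = T i (y - x) + (T i x - x) - (y - x) := by rw [map_sub]; abel
  have h3 : (C + 1) * ‖y - x‖ < ε / 2 := by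
    calc (C + 1) * ‖y - x‖ < (C + 1) * (ε / (2 * (C + 1))) := by gcongr
      _ = ε / 2 := by field_simp
  rw [h2]
  calc ‖T i (y - x) + (T i x - x) - (y - x)‖
      ≤ ‖T i (y - x)‖ + ‖T i x - x‖ + ‖y - x‖ :=
        (norm_sub_le _ _).trans (by gcongr; exact norm_add_le _ _)
    _ < ε := by linarith

theorem isClosed_setOf_cauchySeq {ι : Type*} [SemilatticeSup ι] [Nonempty ι] (T : ι → Y →L[ℂ] Y)
    {C : ℝ} (hT : ∀ᶠ i in atTop, ‖T i‖ ≤ C) : IsClosed {y | CauchySeq fun i => T i y} := by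
  have hC : 0 ≤ C := by
    obtain ⟨i, hi⟩ := hT.exists
    exact (norm_nonneg _).trans hi
  refine isClosed_of_closure_subset fun y hy => ?_
  rw [Set.mem_ofPred_eq, Metric.cauchySeq_iff]
  intro ε hε
  obtain ⟨x, hx, hxy⟩ := Metric.mem_closure_iff.1 hy (ε / (4 * (C + 1))) (by positivity)
  obtain ⟨M, hM⟩ := eventually_atTop.1 hT
  obtain ⟨N, hN⟩ := Metric.cauchySeq_iff.1 hx (ε / 2) (by positivity)
  have h1 : ∀ i ≥ M ⊔ N, ‖T i (y - x)‖ ≤ ε / 4 := fun i hi => by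
    rw [dist_eq_norm] at hxy
    calc ‖T i (y - x)‖ ≤ C * ‖y - x‖ := (T i).le_of_opNorm_le (hM i (le_sup_left.trans hi)) _
      _ ≤ (C + 1) * (ε / (4 * (C + 1))) := by gcongr; linarith
      _ = ε / 4 := by field_simp
  refine ⟨M ⊔ N, fun i hi j hj => ?_⟩
  have h2 := hN i (le_sup_right.trans hi) j (le_sup_right.trans hj)
  rw [dist_eq_norm] at h2 ⊢
  have h3 : T i y - T j y = T i (y - x) - T j (y - x) + (T i x - T j x) := by
    rw [map_sub, map_sub]; abel
  rw [h3]
  refine (norm_add_le _ _).trans_lt ?_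
  linarith [norm_sub_le (T i (y - x)) (T j (y - x)), h1 i hi, h1 j hj]

namespace IsPseudoResolvent

variable {R : ℝ → Y →L[ℂ] Y} {K : ℝ}

theorem norm_le (hR : IsPseudoResolvent R K) {s : ℝ} (hs : 0 < s) : ‖R s‖ ≤ K / s := by
  simpa using hR.norm_pow_le 1 le_rfl s hs

theorem norm_smul_le (hR : IsPseudoResolvent R K) {s : ℝ} (hs : 0 < s) :
    ‖(s : ℂ) • R s‖ ≤ K := by
  rw [norm_smul, Complex.norm_of_nonneg hs.le]
  calc s * ‖R s‖ ≤ s * (K / s) := by gcongr; exact hR.norm_le hs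
    _ = K := by field_simp

theorem commute (hR : IsPseudoResolvent R K) {s t : ℝ} (hs : 0 < s) (ht : 0 < t) :
    Commute (R s) (R t) := by
  rcases eq_or_ne s t with rfl | hst
  · exact Commute.refl _
  have h1 := hR.sub_eq s t hs ht
  have h2 := hR.sub_eq t s ht hs
  have hne : ((t - s : ℝ) : ℂ) ≠ 0 := by
    rw [Ne, Complex.ofReal_eq_zero, sub_eq_zero]; exact hst.symm
  have h3 : ((s - t : ℝ) : ℂ) = -((t - s : ℝ) : ℂ) := by push_cast; ring
  rw [h3, neg_smul, ← neg_sub, neg_inj, h1] at h2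
  exact smul_right_injective _ hne h2

theorem tendsto_apply_zero (hR : IsPseudoResolvent R K) (y : Y) :
    Tendsto (fun s => R s y) atTop (𝓝 0) := by
  have h : Tendsto (fun s : ℝ => K / s * ‖y‖) atTop (𝓝 0) := by
    simpa using (tendsto_const_nhds.div_atTop tendsto_id).mul_const ‖y‖
  refine squeeze_zero_norm' ?_ h
  filter_upwards [eventually_gt_atTop 0] with s hs
  exact (R s).le_of_opNorm_le (hR.norm_le hs) y

/-- This is the resolvent identity between `s` and `1`. The last term is `O(1/s)`, which gives `s
R(s) → 1` on the range of `R 1`. -/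
theorem smul_apply_apply_one (hR : IsPseudoResolvent R K) {s : ℝ} (hs : 0 < s) (y : Y) :
    (s : ℂ) • R s (R 1 y) = R 1 y + R s (R 1 y - y) := by
  have h := congr($(hR.sub_eq s 1 hs one_pos) y)
  simp only [_root_.sub_apply, _root_.smul_apply,
    mul_apply_eq_comp, Complex.ofReal_sub, Complex.ofReal_one, sub_smul, one_smul] at h
  rw [map_sub]
  rw [← sub_sub_cancel (R s (R 1 y)) ((s : ℂ) • R s (R 1 y)), ← h]
  abel

theorem tendsto_smul_apply (hR : IsPseudoResolvent R K) {y : Y}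
    (hy : y ∈ closure (Set.range (R 1))) :
    Tendsto (fun s : ℝ => (s : ℂ) • R s y) atTop (𝓝 y) := by
  have hcl : IsClosed {y | Tendsto (fun s : ℝ => ((s : ℂ) • R s) y) atTop (𝓝 y)} := by
    refine isClosed_setOf_tendsto_self (C := K) _ ?_
    filter_upwards [eventually_gt_atTop 0] with s hs using hR.norm_smul_le hs
  refine hcl.closure_subset_iff.2 ?_ hy
  rintro _ ⟨x, rfl⟩
  have h := (hR.tendsto_apply_zero (R 1 x - x)).const_add (R 1 x)
  rw [add_zero] at h
  refine h.congr' ?_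
  filter_upwards [eventually_gt_atTop 0] with s hs
  exact (hR.smul_apply_apply_one hs x).symm

/-- Consequence of the resolvent identity: the range of each `R s` lies in that of `R 1`. The next
lemma is the counterpart for kernels. -/
theorem apply_eq_apply_one (hR : IsPseudoResolvent R K) {s : ℝ} (hs : 0 < s) (y : Y) :
    R s y = R 1 (y - ((s - 1 : ℝ) : ℂ) • R s y) := by
  have h := congr($(hR.sub_eq 1 s one_pos hs) y)
  simp only [_root_.sub_apply, _root_.smul_apply, mul_apply_eq_comp] at h
  rw [map_sub, map_smul, ← h, sub_sub_cancel]

theorem apply_eq_zero (hR : IsPseudoResolvent R K) {s : ℝ} (hs : 0 < s) {y : Y}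
    (hy : R 1 y = 0) : R s y = 0 := by
  have h := hR.smul_apply_apply_one hs y
  rw [hy, map_zero, smul_zero, zero_add, zero_sub, map_neg, zero_eq_neg] at h
  exact h

theorem denseRange_of_tendsto (hR : IsPseudoResolvent R K)
    (h : ∀ y, Tendsto (fun s : ℝ => (s : ℂ) • R s y) atTop (𝓝 y)) : DenseRange (R 1) := by
  intro y
  refine mem_closure_of_tendsto (h y) ?_
  filter_upwards [eventually_gt_atTop 0] with s hs
  rw [hR.apply_eq_apply_one hs, ← map_smul]
  exact Set.mem_range_self _

end IsPseudoResolvent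

/-! ### Estimates for exponentials of bounded operators -/

theorem hasDerivAt_comp_ofReal {f : ℂ → Y} {f' : Y} {t : ℝ} (h : HasDerivAt f f' (t : ℂ)) :
    HasDerivAt (fun τ : ℝ => f τ) f' t := by
  have h1 := h.scomp_of_eq t Complex.ofRealCLM.hasDerivAt rfl
  rw [Complex.ofRealCLM_apply, Complex.ofReal_one, one_smul] at h1
  exact h1

variable [CompleteSpace Y]

theorem norm_exp_le_of_norm_pow_le {T : Y →L[ℂ] Y} {K r : ℝ} (h : ∀ n, ‖T ^ n‖ ≤ K * r ^ n) :
    ‖exp T‖ ≤ K * Real.exp r := by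
  have h1 := exp_series_hasSum_exp' (𝕂 := ℂ) T
  have h2 := (exp_series_hasSum_exp' (𝕂 := ℝ) r).mul_left K
  rw [← Real.exp_eq_exp_ℝ] at h2
  rw [← h1.tsum_eq]
  refine tsum_of_norm_bounded h2 fun n => ?_
  rw [norm_smul, smul_eq_mul]
  have h3 : ‖((n.factorial : ℂ))⁻¹‖ = ((n.factorial : ℝ))⁻¹ := by simp
  rw [h3]
  calc _ ≤ ((n.factorial : ℝ))⁻¹ * (K * r ^ n) := by gcongr; exact h n
    _ = _ := by ring

theorem exp_add_smul (A : Y →L[ℂ] Y) (a b : ℂ) :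
    exp ((a + b) • A) = exp (a • A) * exp (b • A) := by
  let _ : NormedAlgebra ℚ (Y →L[ℂ] Y) := .restrictScalars ℚ ℂ _
  rw [add_smul]
  exact exp_add_of_commute (((Commute.refl A).smul_left a).smul_right b)

theorem exp_sub_smul_one (T : Y →L[ℂ] Y) (a : ℂ) :
    exp (T - a • (1 : Y →L[ℂ] Y)) = Complex.exp (-a) • exp T := by
  let _ : NormedAlgebra ℚ (Y →L[ℂ] Y) := .restrictScalars ℚ ℂ _
  have h : exp (-(a • (1 : Y →L[ℂ] Y))) = Complex.exp (-a) • (1 : Y →L[ℂ] Y) := by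
    rw [← neg_smul, ← Algebra.algebraMap_eq_smul_one, ← algebraMap_exp_comm,
      Algebra.algebraMap_eq_smul_one, Complex.exp_eq_exp_ℂ]
  rw [sub_eq_add_neg, exp_add_of_commute, h, mul_smul_comm, mul_one]
  exact (((Commute.one_right T).smul_right a).neg_right)

theorem hasDerivAt_exp_smul_apply (A : Y →L[ℂ] Y) (x : Y) (t : ℝ) :
    HasDerivAt (fun τ : ℝ => exp ((τ : ℂ) • A) x) (exp ((t : ℂ) • A) (A x)) t := by
  have h := (hasDerivAt_exp_smul_const A (t : ℂ)).clm_apply (hasDerivAt_const (t : ℂ) x)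
  simpa using hasDerivAt_comp_ofReal h

/-- The path `τ ↦ e^{τA} e^{(t-τ)B} x` joins `e^{tB} x` to `e^{tA} x`. Since `A` and `B` commute,
its derivative is `e^{τA} e^{(t-τ)B} (A x - B x)`, and the mean value inequality applies. -/
theorem norm_exp_smul_sub_le {A B : Y →L[ℂ] Y} {K t : ℝ} (hAB : Commute A B) (ht : 0 ≤ t)
    (hA : ∀ τ : ℝ, 0 ≤ τ → ‖exp ((τ : ℂ) • A)‖ ≤ K)
    (hB : ∀ τ : ℝ, 0 ≤ τ → ‖exp ((τ : ℂ) • B)‖ ≤ K) (x : Y) :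
    ‖exp ((t : ℂ) • A) x - exp ((t : ℂ) • B) x‖ ≤ K * (K * ‖A x - B x‖) * t := by
  have hK : 0 ≤ K := (norm_nonneg _).trans (hA 0 le_rfl)
  have hd : ∀ τ : ℝ, HasDerivAt
      (fun τ : ℝ => exp ((τ : ℂ) • A) (exp (((t : ℂ) - τ) • B) x))
      (exp ((τ : ℂ) • A) (exp (((t - τ : ℝ) : ℂ) • B) (A x - B x))) τ := by
    intro τ
    have h1 := hasDerivAt_exp_smul_const A (τ : ℂ)
    have h2 := ((hasDerivAt_exp_smul_const B ((t : ℂ) - τ)).scomp (τ : ℂ)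
      ((hasDerivAt_id (τ : ℂ)).const_sub (t : ℂ))).clm_apply (hasDerivAt_const (τ : ℂ) x)
    have h3 := hasDerivAt_comp_ofReal (h1.clm_apply h2)
    refine h3.congr_deriv ?_
    have hc : Commute A (exp (((t : ℂ) - τ) • B)) := (hAB.smul_right _).exp_right
    have hc' := congr($(hc.eq) x)
    simp only [mul_apply_eq_comp] at hc'
    simp only [Function.comp_apply, mul_apply_eq_comp, hc', map_sub,
      _root_.neg_apply, map_zero, add_zero, Complex.ofReal_sub, neg_smul, one_smul, map_neg]
    abel
  have h := norm_image_sub_le_of_norm_deriv_le_segment' (a := 0) (b := t)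
    (C := K * (K * ‖A x - B x‖)) (fun τ _ => (hd τ).hasDerivWithinAt) ?_ t ⟨ht, le_rfl⟩
  · simpa [exp_zero] using h
  · intro τ hτ
    refine (ContinuousLinearMap.le_of_opNorm_le _ (hA τ hτ.1) _).trans ?_
    gcongr
    exact ContinuousLinearMap.le_of_opNorm_le _ (hB _ (sub_nonneg.2 hτ.2.le)) _

theorem norm_exp_smul_sub_self_le {A : Y →L[ℂ] Y} {K t : ℝ} (ht : 0 ≤ t)
    (hA : ∀ τ : ℝ, 0 ≤ τ → ‖exp ((τ : ℂ) • A)‖ ≤ K) (x : Y) :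
    ‖exp ((t : ℂ) • A) x - x‖ ≤ K * (K * ‖A x‖) * t := by
  have h1 := hA 0 le_rfl
  simp only [Complex.ofReal_zero, zero_smul, exp_zero] at h1
  simpa [exp_zero] using
    norm_exp_smul_sub_le (Commute.zero_right A) ht hA (fun τ _ => by simpa [exp_zero] using h1) x

/-- A first-order Taylor estimate that avoids `‖A (A x)‖`, which is not controlled uniformly along
the Yosida approximations. The free vector `v` is meant to be close to `A x` with `A v` under
control. -/
theorem norm_exp_smul_sub_self_sub_le {A : Y →L[ℂ] Y} {K t : ℝ} (ht : 0 ≤ t)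
    (hA : ∀ τ : ℝ, 0 ≤ τ → ‖exp ((τ : ℂ) • A)‖ ≤ K) (x v : Y) :
    ‖exp ((t : ℂ) • A) x - x - (t : ℂ) • A x‖ ≤
      ((K + 1) * ‖A x - v‖ + K * (K * ‖A v‖) * t) * t := by
  have hK : 0 ≤ K := (norm_nonneg _).trans (hA 0 le_rfl)
  have hd : ∀ τ : ℝ, HasDerivAt (fun τ : ℝ => exp ((τ : ℂ) • A) x - (τ : ℂ) • A x)
      (exp ((τ : ℂ) • A) (A x) - A x) τ := by
    intro τ
    have h := hasDerivAt_comp_ofReal ((hasDerivAt_id (τ : ℂ)).smul_const (A x))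
    rw [one_smul] at h
    exact (hasDerivAt_exp_smul_apply A x τ).sub h
  have h := norm_image_sub_le_of_norm_deriv_le_segment' (a := 0) (b := t)
    (C := (K + 1) * ‖A x - v‖ + K * (K * ‖A v‖) * t)
    (fun τ _ => (hd τ).hasDerivWithinAt) ?_ t ⟨ht, le_rfl⟩
  · simpa [exp_zero, sub_right_comm] using h
  · intro τ hτ
    have h1 : exp ((τ : ℂ) • A) (A x) - A x =
        exp ((τ : ℂ) • A) (A x - v) - (A x - v) + (exp ((τ : ℂ) • A) v - v) := by
      rw [map_sub]; abel
    have h2 : ‖exp ((τ : ℂ) • A) (A x - v)‖ ≤ K * ‖A x - v‖ :=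
      ContinuousLinearMap.le_of_opNorm_le _ (hA τ hτ.1) _
    have h3 : ‖exp ((τ : ℂ) • A) v - v‖ ≤ K * (K * ‖A v‖) * t :=
      (norm_exp_smul_sub_self_le hτ.1 hA v).trans (by gcongr; exact hτ.2.le)
    rw [h1]
    refine (norm_add_le _ _).trans (add_le_add ((norm_sub_le _ _).trans ?_) h3)
    linarith

end Generation
-- Yosida approximation and the Hille–Yosida theorem
section Generation
open NormedSpace
variable {Y : Type*} [NormedAddCommGroup Y] [NormedSpace ℂ Y]

namespace IsPseudoResolvent

variable {R : ℝ → Y →L[ℂ] Y} {K : ℝ}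

/-- The Yosida approximation `s² R(s) - s`. -/
noncomputable def yosida (R : ℝ → Y →L[ℂ] Y) (s : ℝ) : Y →L[ℂ] Y :=
  ((s ^ 2 : ℝ) : ℂ) • R s - (s : ℂ) • 1

theorem yosida_commute (hR : IsPseudoResolvent R K) {s t : ℝ} (hs : 0 < s) (ht : 0 < t) :
    Commute (yosida R s) (yosida R t) :=
  ((((hR.commute hs ht).smul_left _).sub_left ((Commute.one_left _).smul_left _)).smul_right
    _).sub_right ((Commute.one_right _).smul_right _)

theorem yosida_commute_resolvent (hR : IsPseudoResolvent R K) {s t : ℝ} (hs : 0 < s)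
    (ht : 0 < t) : Commute (yosida R s) (R t) :=
  ((hR.commute hs ht).smul_left _).sub_left ((Commute.one_left _).smul_left _)

theorem yosida_apply_apply_one (hR : IsPseudoResolvent R K) {s : ℝ} (hs : 0 < s) (y : Y) :
    yosida R s (R 1 y) = (s : ℂ) • R s (R 1 y - y) := by
  have h := hR.smul_apply_apply_one hs y
  have h1 : yosida R s (R 1 y) = (s : ℂ) • ((s : ℂ) • R s (R 1 y) - R 1 y) := by
    simp [yosida, smul_sub, smul_smul, sq, -Complex.coe_smul]
  rw [h1, h, add_sub_cancel_left]

theorem tendsto_yosida (hR : IsPseudoResolvent R K) (hd : DenseRange (R 1)) (y : Y) :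
    Tendsto (fun s => yosida R s (R 1 y)) atTop (𝓝 (R 1 y - y)) := by
  refine (hR.tendsto_smul_apply (hd (R 1 y - y))).congr' ?_
  filter_upwards [eventually_gt_atTop 0] with s hs
  exact (hR.yosida_apply_apply_one hs y).symm

/-- The Hille–Yosida bounds start at `n = 1`; this supplies the case `n = 0` for the exponential
series, by letting `s → ∞` in `‖s R(s) y‖ ≤ K ‖y‖`. -/
theorem norm_one_le (hR : IsPseudoResolvent R K) (hd : DenseRange (R 1)) :
    ‖(1 : Y →L[ℂ] Y)‖ ≤ K := by
  refine ContinuousLinearMap.opNorm_le_bound _ hR.pos.le fun y => ?_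
  refine le_of_tendsto (hR.tendsto_smul_apply (hd y)).norm ?_
  filter_upwards [eventually_gt_atTop 0] with s hs
  exact ((s : ℂ) • R s).le_of_opNorm_le (hR.norm_smul_le hs) y

variable [CompleteSpace Y]

/-- The exponential factors as `e^{-ts} exp(t s² R(s))`. The powers of `t s² R(s)` are bounded by `K
(ts)ⁿ`, so the second factor has norm at most `K e^{ts}` and the exponentials cancel. -/
theorem norm_exp_yosida_le (hR : IsPseudoResolvent R K) (hd : DenseRange (R 1)) {s : ℝ}
    (hs : 0 < s) {t : ℝ} (ht : 0 ≤ t) : ‖exp ((t : ℂ) • yosida R s)‖ ≤ K := by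
  have h1 : (t : ℂ) • yosida R s =
      ((t * s ^ 2 : ℝ) : ℂ) • R s - ((t * s : ℝ) : ℂ) • (1 : Y →L[ℂ] Y) := by
    simp [yosida, smul_sub, smul_smul, -Complex.coe_smul]
  have h2 : ‖exp (((t * s ^ 2 : ℝ) : ℂ) • R s)‖ ≤ K * Real.exp (t * s) := by
    refine norm_exp_le_of_norm_pow_le fun n => ?_
    rcases Nat.eq_zero_or_pos n with rfl | hn
    · simpa using hR.norm_one_le hd
    rw [smul_pow, norm_smul, norm_pow, Complex.norm_of_nonneg (by positivity)]
    calc _ ≤ (t * s ^ 2) ^ n * (K / s ^ n) := by gcongr; exact hR.norm_pow_le n hn s hs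
      _ = K * (t * s) ^ n := by
        have hsn : s ^ n ≠ 0 := by positivity
        rw [mul_pow, mul_pow, ← pow_mul, mul_comm 2 n, pow_mul]; field_simp
  rw [h1, exp_sub_smul_one, norm_smul, ← Complex.ofReal_neg, ← Complex.ofReal_exp,
    Complex.norm_of_nonneg (Real.exp_nonneg _)]
  calc _ ≤ Real.exp (-(t * s)) * (K * Real.exp (t * s)) := by gcongr
    _ = K * (Real.exp (-(t * s)) * Real.exp (t * s)) := by ring
    _ = K := by rw [← Real.exp_add]; simp

theorem cauchy_exp_yosida (hR : IsPseudoResolvent R K) (hd : DenseRange (R 1)) {t : ℝ}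
    (ht : 0 ≤ t) (y : Y) : CauchySeq fun s => exp ((t : ℂ) • yosida R s) y := by
  have hK := hR.pos
  have hpos : ∀ᶠ s : ℝ in atTop, 0 < s := eventually_gt_atTop 0
  refine (isClosed_setOf_cauchySeq (fun s => exp ((t : ℂ) • yosida R s)) (C := K)
    ?_).closure_subset_iff.2
    ?_ (hd y)
  · filter_upwards [hpos] with s hs using hR.norm_exp_yosida_le hd hs ht
  rintro _ ⟨w, rfl⟩
  rw [Set.mem_ofPred_eq, Metric.cauchySeq_iff]
  intro ε hε
  -- The tolerance absorbs the factor `K² t` of `norm_exp_smul_sub_le`; `t + 1` replaces `t` so that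
  -- `t = 0` is allowed.
  obtain ⟨N, hN⟩ := Metric.cauchySeq_iff.1 (hR.tendsto_yosida hd w).cauchySeq
    (ε / (2 * K * K * (t + 1))) (by positivity)
  refine ⟨max N 1, fun s hs r hr => ?_⟩
  have hs1 : 0 < s := one_pos.trans_le ((le_max_right _ _).trans hs)
  have hr1 : 0 < r := one_pos.trans_le ((le_max_right _ _).trans hr)
  have h1 := norm_exp_smul_sub_le (hR.yosida_commute hs1 hr1) ht
    (fun τ hτ => hR.norm_exp_yosida_le hd hs1 hτ) (fun τ hτ => hR.norm_exp_yosida_le hd hr1 hτ)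
    (R 1 w)
  have h3 := hN s ((le_max_left _ _).trans hs) r ((le_max_left _ _).trans hr)
  rw [dist_eq_norm] at h3 ⊢
  refine h1.trans_lt ?_
  calc _ ≤ K * (K * (ε / (2 * K * K * (t + 1)))) * (t + 1) := by gcongr; linarith
    _ = ε / 2 := by field_simp
    _ < ε := half_lt_self hε

/-- The strong limit of the exponentials of the Yosida approximations. -/
theorem exists_tendsto_exp_yosida (hR : IsPseudoResolvent R K) (hd : DenseRange (R 1)) :
    ∃ S : ℝ≥0 → Y →L[ℂ] Y, ∀ (t : ℝ≥0) (y : Y),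
      Tendsto (fun s => exp (((t : ℝ) : ℂ) • yosida R s) y) atTop (𝓝 (S t y)) := by
  choose f hf using fun (t : ℝ≥0) (y : Y) =>
    cauchySeq_tendsto_of_complete (hR.cauchy_exp_yosida hd t.2 y)
  exact ⟨fun t => continuousLinearMapOfTendsto (fun s => exp (((t : ℝ) : ℂ) • yosida R s))
    (tendsto_pi_nhds.2 (hf t)), hf⟩

/-- The Hille–Yosida generation theorem, for pseudo-resolvents with dense range. -/
theorem exists_semigroup (hR : IsPseudoResolvent R K) (hd : DenseRange (R 1)) :
    ∃ S : ℝ≥0 → Y →L[ℂ] Y, IsC0Semigroup S ∧ (∀ t, ‖S t‖ ≤ K) ∧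
      ∀ y z : Y, Tendsto (fun t : ℝ≥0 => ((t : ℝ) : ℂ)⁻¹ • (S t y - y)) (𝓝[>] 0) (𝓝 z) ↔
        y = R 1 (y - z) := by
  obtain ⟨S, hS⟩ := hR.exists_tendsto_exp_yosida hd
  have hpos : ∀ᶠ s : ℝ in atTop, 0 < s := eventually_gt_atTop 0
  have hbound : ∀ t, ‖S t‖ ≤ K := fun t => by
    refine ContinuousLinearMap.opNorm_le_bound _ hR.pos.le fun y => ?_
    refine le_of_tendsto (hS t y).norm ?_
    filter_upwards [hpos] with s hs
    exact ContinuousLinearMap.le_of_opNorm_le _ (hR.norm_exp_yosida_le hd hs t.2) y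
  have hcomm : ∀ (t : ℝ≥0) (y : Y), S t (R 1 y) = R 1 (S t y) := fun t y => by
    refine tendsto_nhds_unique (hS t (R 1 y)) ?_
    refine (((R 1).continuous.tendsto _).comp (hS t y)).congr' ?_
    filter_upwards [hpos] with s hs
    have h : Commute (exp (((t : ℝ) : ℂ) • yosida R s)) (R 1) :=
      ((hR.yosida_commute_resolvent hs one_pos).smul_left _).exp_left
    exact congr($(h.eq) y).symm
  have hlip : ∀ (t : ℝ≥0) (y : Y), ‖S t (R 1 y) - R 1 y‖ ≤
      K * (K * ‖R 1 y - y‖) * t := fun t y => by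
    refine le_of_tendsto_of_tendsto ((hS t (R 1 y)).sub_const _).norm
      ((((hR.tendsto_yosida hd y).norm.const_mul K).const_mul K).mul_const (t : ℝ)) ?_
    filter_upwards [hpos] with s hs
    exact norm_exp_smul_sub_self_le t.2 (fun τ hτ => hR.norm_exp_yosida_le hd hs hτ) _
  -- The comparison vector is taken as `R 1 v`, on which the Yosida approximations converge, so the
  -- Taylor estimate survives the limit `s → ∞`.
  have hdiff : ∀ (t : ℝ≥0) y v, ‖S t (R 1 y) - R 1 y - ((t : ℝ) : ℂ) • (R 1 y - y)‖ ≤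
      ((K + 1) * ‖R 1 y - y - R 1 v‖ + K * (K * ‖R 1 v - v‖) * t) * t := fun t y v => by
    have hy := hR.tendsto_yosida hd y
    refine le_of_tendsto_of_tendsto
      (((hS t (R 1 y)).sub_const _).sub (hy.const_smul ((t : ℝ) : ℂ))).norm
      ((((hy.sub_const (R 1 v)).norm.const_mul (K + 1)).add
        ((((hR.tendsto_yosida hd v).norm.const_mul K).const_mul K).mul_const (t : ℝ))).mul_const
        (t : ℝ)) ?_
    filter_upwards [hpos] with s hs
    exact norm_exp_smul_sub_self_sub_le t.2 (fun τ hτ => hR.norm_exp_yosida_le hd hs hτ) _ _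
  have hcoe : Tendsto (fun t : ℝ≥0 => (t : ℝ)) (𝓝[>] 0) (𝓝 0) :=
    (NNReal.continuous_coe.tendsto' 0 0 rfl).mono_left nhdsWithin_le_nhds
  -- The range of `R 1` lies in the domain of the generator. Density lets `R 1 v` approximate `R 1 y
  -- - y`, and the remaining error vanishes with `t`.
  have hgen : ∀ y, Tendsto (fun t : ℝ≥0 => ((t : ℝ) : ℂ)⁻¹ • (S t (R 1 y) - R 1 y)) (𝓝[>] 0)
      (𝓝 (R 1 y - y)) := fun y => by
    have hK := hR.pos
    rw [Metric.tendsto_nhds]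
    intro ε hε
    obtain ⟨_, ⟨v, rfl⟩, hv⟩ :=
      Metric.mem_closure_iff.1 (hd (R 1 y - y)) (ε / (2 * (K + 1))) (by positivity)
    have h0 : Tendsto (fun t : ℝ≥0 => K * (K * ‖R 1 v - v‖) * (t : ℝ)) (𝓝[>] 0) (𝓝 0) := by
      simpa using hcoe.const_mul (K * (K * ‖R 1 v - v‖))
    filter_upwards [self_mem_nhdsWithin, h0.eventually_lt_const (half_pos hε)] with t ht hlt
    have ht0 : (0 : ℝ) < t := ht
    have ht1 : ((t : ℝ) : ℂ) ≠ 0 := Complex.ofReal_ne_zero.2 ht0.ne'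
    have h1 : ((t : ℝ) : ℂ)⁻¹ • (S t (R 1 y) - R 1 y) - (R 1 y - y) =
        ((t : ℝ) : ℂ)⁻¹ • (S t (R 1 y) - R 1 y - ((t : ℝ) : ℂ) • (R 1 y - y)) := by
      rw [smul_sub _ (S t (R 1 y) - R 1 y), inv_smul_smul₀ ht1]
    rw [dist_eq_norm] at hv ⊢
    have h2 : (K + 1) * ‖R 1 y - y - R 1 v‖ < ε / 2 := by
      calc _ < (K + 1) * (ε / (2 * (K + 1))) := by gcongr
        _ = ε / 2 := by field_simp
    rw [h1, norm_smul, norm_inv, Complex.norm_of_nonneg ht0.le, inv_mul_lt_iff₀ ht0, mul_comm]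
    refine (hdiff t y v).trans_lt ?_
    gcongr
    linarith
  refine ⟨S, ⟨?_, ?_, ?_⟩, hbound, fun y z => ⟨fun h => ?_, fun h => ?_⟩⟩
  · ext y
    refine tendsto_nhds_unique (hS 0 y) ?_
    simp [exp_zero]
  · intro a b
    ext y
    refine tendsto_nhds_unique (hS (a + b) y) ?_
    -- Strong limits multiply here because the left factors are bounded by `K` uniformly in `s`.
    have h1 : Tendsto (fun s => exp (((a : ℝ) : ℂ) • yosida R s)
        (exp (((b : ℝ) : ℂ) • yosida R s) y - S b y)) atTop (𝓝 0) := by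
      have h2 := ((hS b y).sub_const (S b y)).norm.const_mul K
      rw [sub_self, norm_zero, mul_zero] at h2
      refine squeeze_zero_norm' ?_ h2
      filter_upwards [hpos] with s hs
      exact ContinuousLinearMap.le_of_opNorm_le _ (hR.norm_exp_yosida_le hd hs a.2) _
    have h3 := h1.add (hS a (S b y))
    rw [zero_add] at h3
    refine h3.congr fun s => ?_
    rw [map_sub, sub_add_cancel, NNReal.coe_add, Complex.ofReal_add, exp_add_smul]
    rfl
  · have hcl := isClosed_setOf_tendsto_self (l := 𝓝[>] 0) S (Eventually.of_forall hbound)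
    intro y
    refine hcl.closure_subset_iff.2 ?_ (hd y)
    rintro _ ⟨x, rfl⟩
    refine tendsto_iff_norm_sub_tendsto_zero.2 (squeeze_zero (fun _ => norm_nonneg _)
      (fun t => hlip t x) ?_)
    simpa using hcoe.const_mul (K * (K * ‖R 1 x - x‖))
  -- Conversely, `R 1` commutes with `S t`, so applying it to the difference quotient gives both `R
  -- 1 z` and `R 1 y - y` as limits. Hence the domain is no larger than the range of `R 1`.
  · have h1 := ((R 1).continuous.tendsto _).comp h
    have h2 := tendsto_nhds_unique (h1.congr fun t => by
      rw [Function.comp_apply, map_smul, map_sub, ← hcomm]) (hgen y)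
    rw [map_sub, h2, sub_sub_cancel]
  · have h1 := hgen (y - z)
    rwa [← h, sub_sub_cancel] at h1

end IsPseudoResolvent
end Generation
-- Rescaling by `e^{αt}`
section Generation
variable {Y : Type*} [NormedAddCommGroup Y] [NormedSpace ℂ Y] [CompleteSpace Y]
  {R : ℝ → Y →L[ℂ] Y} {K : ℝ}

/-- The Hille–Yosida generation theorem for a generator shifted by `α`. -/
theorem IsPseudoResolvent.exists_semigroup_rescaled (hR : IsPseudoResolvent R K)
    (hd : DenseRange (R 1)) (α : ℝ) :
    ∃ S : ℝ≥0 → Y →L[ℂ] Y, IsC0Semigroup S ∧ (∀ t : ℝ≥0, ‖S t‖ ≤ K * Real.exp (α * t)) ∧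
      ∀ y z : Y, Tendsto (fun t : ℝ≥0 => ((t : ℝ) : ℂ)⁻¹ • (S t y - y)) (𝓝[>] 0) (𝓝 z) ↔
        y = R 1 (y - (z - (α : ℂ) • y)) := by
  obtain ⟨S, hS, hbound, hgen⟩ := hR.exists_semigroup hd
  have hexp0 : Tendsto (fun t : ℝ≥0 => Complex.exp (α * (t : ℝ))) (𝓝[>] 0) (𝓝 1) := by
    have h : Continuous fun t : ℝ≥0 => Complex.exp (α * (t : ℝ)) := by fun_prop
    exact (h.tendsto' 0 1 (by simp)).mono_left nhdsWithin_le_nhds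
  have hexp1 : Tendsto (fun t : ℝ≥0 => ((t : ℝ) : ℂ)⁻¹ * (Complex.exp (α * (t : ℝ)) - 1)) (𝓝[>] 0)
      (𝓝 α) := by
    have h1 : HasDerivAt (fun z : ℂ => Complex.exp (α * z)) α 0 := by
      simpa using ((hasDerivAt_id (0 : ℂ)).const_mul (α : ℂ)).cexp
    have h2 : Tendsto (fun t : ℝ≥0 => ((t : ℝ) : ℂ)) (𝓝[>] 0) (𝓝[≠] 0) := by
      refine tendsto_nhdsWithin_iff.2 ⟨?_, ?_⟩
      · have h : Continuous fun t : ℝ≥0 => ((t : ℝ) : ℂ) := by fun_prop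
        exact (h.tendsto' 0 0 (by simp)).mono_left nhdsWithin_le_nhds
      · filter_upwards [self_mem_nhdsWithin] with t ht
        have ht0 : (0 : ℝ≥0) < t := ht
        simpa using ht0.ne'
    refine (h1.tendsto_slope_zero.comp h2).congr fun t => ?_
    simp
  -- The two difference quotients differ by the factor `e^{αt} → 1` and by the term `t⁻¹ (e^{αt} -
  -- 1) y → α y`.
  have hkey : ∀ y z : Y, Tendsto (fun t : ℝ≥0 => ((t : ℝ) : ℂ)⁻¹ •
      (Complex.exp (α * (t : ℝ)) • S t y - y)) (𝓝[>] 0) (𝓝 z) ↔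
      Tendsto (fun t : ℝ≥0 => ((t : ℝ) : ℂ)⁻¹ • (S t y - y)) (𝓝[>] 0) (𝓝 (z - (α : ℂ) • y)) := by
    intro y z
    constructor
    · intro h
      have h1 := (hexp0.inv₀ one_ne_zero).smul (h.sub (hexp1.smul_const y))
      rw [inv_one, one_smul] at h1
      refine h1.congr fun t => ?_
      rw [inv_smul_eq_iff₀ (Complex.exp_ne_zero _)]
      module
    · intro h
      have h1 := (hexp0.smul h).add (hexp1.smul_const y)
      rw [one_smul, sub_add_cancel] at h1
      refine h1.congr fun t => ?_
      module
  refine ⟨fun t => Complex.exp (α * (t : ℝ)) • S t, ⟨?_, ?_, ?_⟩, fun t => ?_, fun y z => ?_⟩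
  · simp [hS.map_zero]
  · intro s t
    ext y
    simp [hS.map_add, mul_add, Complex.exp_add, smul_smul, mul_comm]
  · intro y
    simpa using hexp0.smul (hS.tendsto_zero y)
  · rw [norm_smul, ← Complex.ofReal_mul, ← Complex.ofReal_exp,
      Complex.norm_of_nonneg (Real.exp_nonneg _), mul_comm]
    gcongr
    exact hbound t
  · exact (hkey y z).trans (hgen y _)

end Generation

/-! ### Splitting of a Hilbert space by a pseudo-resolvent -/

section Hilbert

variable {X : Type*} [NormedAddCommGroup X] [InnerProductSpace ℂ X] [CompleteSpace X]
  {R : ℝ → X →L[ℂ] X} {K : ℝ}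

namespace IsPseudoResolvent

theorem star (hR : IsPseudoResolvent R K) : IsPseudoResolvent (fun s => star (R s)) K where
  pos := hR.pos
  sub_eq s t hs ht := by
    rw [← star_sub, hR.sub_eq s t hs ht, (hR.commute hs ht).eq, star_smul, star_mul]
    simp
  norm_pow_le n hn s hs := by
    rw [← star_pow, norm_star]
    exact hR.norm_pow_le n hn s hs

/-- The orthogonal complement of the sum is the intersection of the closed range and the kernel of
the adjoint of `R 1`. For `y` in it, the adjoint family gives `s R(s)* y → y`, while every `R(s)* y`
is `0`. -/
theorem dense_ker_sup_range (hR : IsPseudoResolvent R K) :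
    Dense (((R 1).ker ⊔ (R 1).range : Submodule ℂ X) : Set X) := by
  rw [Submodule.dense_iff_topologicalClosure_eq_top, Submodule.topologicalClosure_eq_top_iff,
    ← Submodule.inf_orthogonal, ContinuousLinearMap.orthogonal_ker,
    ContinuousLinearMap.orthogonal_range, Submodule.eq_bot_iff]
  rintro y ⟨hy, hy0⟩
  have h1 := hR.star.tendsto_smul_apply hy
  refine (tendsto_nhds_unique (h1.congr' ?_) tendsto_const_nhds)
  filter_upwards [eventually_gt_atTop 0] with s hs
  rw [hR.star.apply_eq_zero hs hy0, smul_zero]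

/-- The component `w` is the limit of `s R(s) x`. This limit exists on kernel plus range, hence
everywhere by density and the uniform bound. Commuting `R 1` past `s R(s)` gives `R 1 w = R 1 x`. -/
theorem exists_ker_add_closure_range (hR : IsPseudoResolvent R K) (x : X) :
    ∃ w ∈ closure (Set.range (R 1)), R 1 (x - w) = 0 := by
  have hcau : CauchySeq fun s : ℝ => ((s : ℂ) • R s) x := by
    refine (isClosed_setOf_cauchySeq (fun s : ℝ => (s : ℂ) • R s) (C := K)
    ?_).closure_subset_iff.2
      ?_ (hR.dense_ker_sup_range x)
    · filter_upwards [eventually_gt_atTop 0] with s hs using hR.norm_smul_le hs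
    intro y hy
    obtain ⟨k, hk, r, hr, rfl⟩ := Submodule.mem_sup.1 hy
    refine ((hR.tendsto_smul_apply (subset_closure hr)).congr' ?_).cauchySeq
    filter_upwards [eventually_gt_atTop 0] with s hs
    rw [_root_.smul_apply, map_add, hR.apply_eq_zero hs hk, zero_add]
  obtain ⟨w, hw⟩ := cauchySeq_tendsto_of_complete hcau
  refine ⟨w, mem_closure_of_tendsto hw ?_, ?_⟩
  · filter_upwards [eventually_gt_atTop 0] with s hs
    rw [_root_.smul_apply, hR.apply_eq_apply_one hs, ← map_smul]
    exact Set.mem_range_self _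
  · have h1 := ((R 1).continuous.tendsto _).comp hw
    have h2 := hR.tendsto_smul_apply (subset_closure (Set.mem_range_self x))
    rw [map_sub, sub_eq_zero]
    refine tendsto_nhds_unique (h2.congr' ?_) h1
    filter_upwards [eventually_gt_atTop 0] with s hs
    have h := congr($((hR.commute hs one_pos).eq) x)
    simp only [mul_apply_eq_comp] at h
    simp [h]

end IsPseudoResolvent
end Hilbert
-- Resolvents of the pencil
section Pencil

variable {X Z : Type*} [NormedAddCommGroup X] [InnerProductSpace ℂ X]
  [NormedAddCommGroup Z] [InnerProductSpace ℂ Z] {E : X →L[ℂ] Z} {A : X →ₗ.[ℂ] Z} {s t : ℂ}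

theorem isBoundedInverse_resolvent (hs : s ∈ resolventSet E A) :
    IsBoundedInverse (pencil E A s) (resolvent E A s) := by
  have h : ∃ R : Z →L[ℂ] X, IsBoundedInverse (pencil E A s) R := hs
  rw [resolvent, dif_pos h]
  exact h.choose_spec

theorem exists_apply_resolvent (hs : s ∈ resolventSet E A) (z : Z) :
    ∃ h : resolvent E A s z ∈ A.domain,
      A ⟨resolvent E A s z, h⟩ = s • E (resolvent E A s z) - z := by
  obtain ⟨h, hz⟩ := (isBoundedInverse_resolvent hs).1 z
  refine ⟨h, ?_⟩
  have h1 : s • E (resolvent E A s z) + -A ⟨resolvent E A s z, h⟩ = z := hz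
  rw [← sub_eq_add_neg, sub_eq_iff_eq_add] at h1
  rw [eq_sub_iff_add_eq, h1, add_comm]

theorem resolvent_apply_sub (hs : s ∈ resolventSet E A) (x : A.domain) :
    resolvent E A s (s • E x - A x) = x := by
  have h : resolvent E A s (s • E x + -A x) = x := (isBoundedInverse_resolvent hs).2 x
  rwa [sub_eq_add_neg]

/-- The resolvent identity. -/
theorem resolvent_apply_eq (hs : s ∈ resolventSet E A) (ht : t ∈ resolventSet E A) (z : Z) :
    resolvent E A s z =
      resolvent E A t z + (t - s) • resolvent E A s (E (resolvent E A t z)) := by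
  obtain ⟨h, hz⟩ := exists_apply_resolvent ht z
  -- With `x` the value at `z` of the resolvent at `t`, invert `sE - A` on `x`; the relation `A x =
  -- t E x - z` then yields the identity.
  have h1 : resolvent E A s (s • E (resolvent E A t z) - A ⟨_, h⟩) = resolvent E A t z :=
    resolvent_apply_sub hs ⟨_, h⟩
  rw [hz] at h1
  refine Eq.trans ?_ (congrArg (· + (t - s) • resolvent E A s (E (resolvent E A t z))) h1)
  rw [← (resolvent E A s).map_smul, ← (resolvent E A s).map_add]
  congr 1
  module

theorem pencil_shift (E : X →L[ℂ] Z) (A : X →ₗ.[ℂ] Z) (c s : ℂ) :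
    pencil E (shift E A c) s = pencil E A (s + c) := by
  refine LinearPMap.ext rfl fun x hx _ => ?_
  have h : ∀ h : x ∈ A.domain, s • E x + -(-(c • E x) + A ⟨x, h⟩) = (s + c) • E x + -A ⟨x, h⟩ :=
    fun _ => by module
  exact h hx

theorem resolventSet_shift (E : X →L[ℂ] Z) (A : X →ₗ.[ℂ] Z) (c s : ℂ) :
    s ∈ resolventSet E (shift E A c) ↔ s + c ∈ resolventSet E A := by
  simp only [resolventSet, Set.mem_ofPred_eq, pencil_shift]

open Classical in
theorem resolvent_shift (E : X →L[ℂ] Z) (A : X →ₗ.[ℂ] Z) (c s : ℂ) :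
    resolvent E (shift E A c) s = resolvent E A (s + c) := by
  have h : ∀ P Q : X →ₗ.[ℂ] Z, P = Q →
      (if h : ∃ R : Z →L[ℂ] X, IsBoundedInverse P R then h.choose else 0) =
        if h : ∃ R : Z →L[ℂ] X, IsBoundedInverse Q R then h.choose else 0 := by
    rintro P _ rfl
    rfl
  exact h _ _ (pencil_shift E A c s)

/-- The resolvent identity factors the resolvent at `s` through the one at `t`. By symmetry the
ranges coincide, so `X¹` is independent of `β` and can be computed at `1 + α`; likewise `Z¹` below.
-/
theorem range_rightResolvent_subset (hs : s ∈ resolventSet E A) (ht : t ∈ resolventSet E A) :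
    Set.range (rightResolvent E A s) ⊆ Set.range (rightResolvent E A t) := by
  rintro _ ⟨x, rfl⟩
  refine ⟨x - (s - t) • rightResolvent E A s x, ?_⟩
  rw [map_sub, map_smul, sub_eq_iff_eq_add]
  exact resolvent_apply_eq ht hs (E x)

theorem range_leftResolvent_subset (hs : s ∈ resolventSet E A) (ht : t ∈ resolventSet E A) :
    Set.range (leftResolvent E A s) ⊆ Set.range (leftResolvent E A t) := by
  rintro _ ⟨z, rfl⟩
  refine ⟨z - (s - t) • leftResolvent E A s z, ?_⟩
  rw [map_sub, map_smul, sub_eq_iff_eq_add]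
  have h := congr(E $(resolvent_apply_eq ht hs z))
  rwa [map_add, map_smul] at h

theorem coe_X1 (hs : s ∈ resolventSet E A) (ht : t ∈ resolventSet E A) :
    (X1 E A s : Set X) = closure (Set.range (rightResolvent E A t)) := by
  rw [← (range_rightResolvent_subset hs ht).antisymm (range_rightResolvent_subset ht hs)]
  rfl

theorem coe_Z1 (hs : s ∈ resolventSet E A) (ht : t ∈ resolventSet E A) :
    (Z1 E A s : Set Z) = closure (Set.range (leftResolvent E A t)) := by
  rw [← (range_leftResolvent_subset hs ht).antisymm (range_leftResolvent_subset ht hs)]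
  rfl

/-- The right resolvent as an operator on `X¹`. -/
noncomputable def rightResolvent1 (E : X →L[ℂ] Z) (A : X →ₗ.[ℂ] Z) {β : ℂ}
    (hβ : β ∈ resolventSet E A) (hs : s ∈ resolventSet E A) : X1 E A β →L[ℂ] X1 E A β :=
  ((rightResolvent E A s).comp (X1 E A β).subtypeL).codRestrict (X1 E A β) fun x => by
    rw [← SetLike.mem_coe, coe_X1 hβ hs]
    exact subset_closure (Set.mem_range_self _)

/-! ### Radial pencils: restriction to `X¹` and `Z¹` -/

namespace IsRadialWith

variable {α K : ℝ} (h : IsRadialWith E (shift E A (α : ℂ)) K)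

include h

theorem mem_resolventSet_add {s : ℝ} (hs : 0 < s) : (s : ℂ) + α ∈ resolventSet E A :=
  (resolventSet_shift E A α s).1 (h.mem_resolventSet s hs)

theorem isPseudoResolvent_right :
    IsPseudoResolvent (fun s : ℝ => rightResolvent E A ((s : ℂ) + α)) K where
  pos := h.pos
  sub_eq s t hs ht := by
    ext x
    have h1 := resolvent_apply_eq (h.mem_resolventSet_add hs) (h.mem_resolventSet_add ht) (E x)
    rw [add_sub_add_right_eq_sub, ← Complex.ofReal_sub] at h1
    exact sub_eq_iff_eq_add'.2 h1
  norm_pow_le n hn s hs := by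
    have h1 := h.norm_rightResolvent_pow_le n hn s hs
    rwa [rightResolvent, resolvent_shift] at h1

theorem isPseudoResolvent_left :
    IsPseudoResolvent (fun s : ℝ => leftResolvent E A ((s : ℂ) + α)) K where
  pos := h.pos
  sub_eq s t hs ht := by
    ext z
    have h1 := congr(E
      $(resolvent_apply_eq (h.mem_resolventSet_add hs) (h.mem_resolventSet_add ht) z))
    rw [add_sub_add_right_eq_sub, ← Complex.ofReal_sub, map_add, map_smul] at h1
    exact sub_eq_iff_eq_add'.2 h1
  norm_pow_le n hn s hs := by
    have h1 := h.norm_leftResolvent_pow_le n hn s hs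
    rwa [leftResolvent, resolvent_shift] at h1

variable {β : ℂ} (hβ : β ∈ resolventSet E A)

include hβ

theorem mem_X1_iff {x : X} :
    x ∈ X1 E A β ↔ x ∈ closure (Set.range (rightResolvent E A (((1 : ℝ) : ℂ) + α))) := by
  rw [← coe_X1 hβ (h.mem_resolventSet_add one_pos), SetLike.mem_coe]

theorem mem_Z1_iff {z : Z} :
    z ∈ Z1 E A β ↔ z ∈ closure (Set.range (leftResolvent E A (((1 : ℝ) : ℂ) + α))) := by
  rw [← coe_Z1 hβ (h.mem_resolventSet_add one_pos), SetLike.mem_coe]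

theorem tendsto_smul_rightResolvent {x : X} (hx : x ∈ X1 E A β) :
    Tendsto (fun s : ℝ => (s : ℂ) • rightResolvent E A ((s : ℂ) + α) x) atTop (𝓝 x) :=
  h.isPseudoResolvent_right.tendsto_smul_apply ((h.mem_X1_iff hβ).1 hx)

/-- The restriction of the right resolvents to `X¹`, extended by zero to nonpositive `s`. -/
theorem exists_isPseudoResolvent_restrict :
    ∃ R : ℝ → X1 E A β →L[ℂ] X1 E A β, IsPseudoResolvent R K ∧ DenseRange (R 1) ∧
      ∀ s : ℝ, 0 < s → ∀ x, (R s x : X) = rightResolvent E A ((s : ℂ) + α) x := by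
  classical
  have hR := h.isPseudoResolvent_right
  let R : ℝ → X1 E A β →L[ℂ] X1 E A β := fun s =>
    if hs : 0 < s then rightResolvent1 E A hβ (h.mem_resolventSet_add hs) else 0
  have hcoe : ∀ s : ℝ, 0 < s → ∀ x, (R s x : X) = rightResolvent E A ((s : ℂ) + α) x := by
    intro s hs x
    simp only [R, dif_pos hs]
    rfl
  have hpow : ∀ s : ℝ, 0 < s → ∀ n : ℕ, ∀ x,
      (((R s) ^ n) x : X) = (rightResolvent E A ((s : ℂ) + α) ^ n) x := by
    intro s hs n
    induction n with
    | zero => simp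
    | succ n ih =>
      intro x
      rw [pow_succ, mul_apply_eq_comp, ih, hcoe s hs, pow_succ, mul_apply_eq_comp]
  have hR1 : IsPseudoResolvent R K := by
    refine ⟨h.pos, fun s t hs ht => ?_, fun n hn s hs => ?_⟩
    · ext x
      simpa [hcoe s hs, hcoe t ht] using congr($(hR.sub_eq s t hs ht) (x : X))
    · refine ContinuousLinearMap.opNorm_le_bound _ (div_nonneg h.pos.le (by positivity)) fun x => ?_
      change ‖((R s ^ n) x : X)‖ ≤ _
      rw [hpow s hs]
      exact ContinuousLinearMap.le_of_opNorm_le _ (hR.norm_pow_le n hn s hs) _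
  -- `X¹` is the closure of a range taken over all of `X`; that the image of `X¹` alone is already
  -- dense follows from `s R(s) x → x` on `X¹`.
  refine ⟨R, hR1, hR1.denseRange_of_tendsto fun x => ?_, hcoe⟩
  rw [tendsto_subtype_rng]
  refine (h.tendsto_smul_rightResolvent hβ x.2).congr' ?_
  filter_upwards [eventually_gt_atTop 0] with s hs
  rw [Submodule.coe_smul, hcoe s hs]

variable [CompleteSpace Z]

/-- Let `w` be the `Z¹` component of `A x - α E x`. The vectors `s R(s) x` tend to `x`, and `A`
sends them to `s L(s) (A x - α E x) + α E (s R(s) x)`, with resolvents at `s + α`, which tends to `w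
+ α E x`. As the graph is closed, `A x = w + α E x`, and both terms lie in `Z¹`. -/
theorem apply_mem_Z1 (hA : A.IsClosed) (x : A.domain) (hx : (x : X) ∈ X1 E A β) :
    A x ∈ Z1 E A β := by
  have hL := h.isPseudoResolvent_left
  obtain ⟨w, hw, hw0⟩ := hL.exists_ker_add_closure_range (A x - (α : ℂ) • E x)
  have hxlim := h.tendsto_smul_rightResolvent hβ hx
  have hlim : Tendsto (fun s : ℝ => (s : ℂ) • leftResolvent E A ((s : ℂ) + α) (A x - (α : ℂ) • E x)
      + (α : ℂ) • E ((s : ℂ) • rightResolvent E A ((s : ℂ) + α) x)) atTop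
      (𝓝 (w + (α : ℂ) • E x)) := by
    refine Tendsto.add ((hL.tendsto_smul_apply hw).congr' ?_)
      (((E.continuous.tendsto _).comp hxlim).const_smul _)
    filter_upwards [eventually_gt_atTop 0] with s hs
    have h0 := hL.apply_eq_zero hs hw0
    rw [map_sub, sub_eq_zero] at h0
    rw [h0]
  have hmem : ((x : X), w + (α : ℂ) • E x) ∈ A.graph := by
    refine hA.mem_of_tendsto (hxlim.prodMk_nhds hlim) ?_
    filter_upwards [eventually_gt_atTop 0] with s hs
    have hs' := h.mem_resolventSet_add hs
    obtain ⟨h1, h2⟩ := exists_apply_resolvent hs' (E x)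
    have h3 : resolvent E A ((s : ℂ) + α) (A x) =
        ((s : ℂ) + α) • resolvent E A ((s : ℂ) + α) (E x) - x := by
      rw [← map_smul, eq_sub_iff_add_eq, ← eq_sub_iff_add_eq', ← map_sub, resolvent_apply_sub hs']
    have h4 := A.graph.smul_mem (s : ℂ) (A.mem_graph ⟨_, h1⟩)
    rw [h2] at h4
    refine SetLike.mem_coe.2 ?_
    convert h4 using 1
    refine Prod.ext rfl ?_
    simp only [leftResolvent, rightResolvent, ContinuousLinearMap.comp_apply, map_sub, map_smul, h3,
      Prod.smul_snd]
    module
  obtain ⟨y, hy, hyw⟩ := A.mem_graph_iff.1 hmem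
  obtain rfl : y = x := Subtype.ext hy
  rw [hyw]
  exact (Z1 E A β).add_mem ((h.mem_Z1_iff hβ).2 hw)
    ((Z1 E A β).smul_mem _ (map_mem_Z1 E A β ⟨_, hx⟩))

variable [CompleteSpace X]

/-- Injectivity: if `E x = 0` then `s R(s) x = 0`, yet this tends to `x` on `X¹`. Surjectivity: `Z¹`
lies in the closed set `ran E`, and subtracting the kernel component of a preimage does not change
its image under `E`. Boundedness of the inverse is the open mapping theorem. -/
theorem isInvertible_E1 (h_range : IsClosed (Set.range E)) : (E1 E A β).IsInvertible := by
  have hR := h.isPseudoResolvent_right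
  have : CompleteSpace (X1 E A β) := (Submodule.isClosed_topologicalClosure _).completeSpace_coe
  have : CompleteSpace (Z1 E A β) := (Submodule.isClosed_topologicalClosure _).completeSpace_coe
  have hker : (E1 E A β).ker = ⊥ := by
    rw [Submodule.eq_bot_iff]
    intro x hx
    have hx0 : E x = 0 := congrArg Subtype.val hx
    refine Subtype.ext (tendsto_nhds_unique (h.tendsto_smul_rightResolvent hβ x.2) ?_)
    simp [rightResolvent, hx0]
  have hsurj : (E1 E A β).range = ⊤ := by
    rw [Submodule.eq_top_iff']
    intro z
    have hz : (z : Z) ∈ Set.range E := by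
      refine closure_minimal ?_ h_range z.2
      rintro _ ⟨y, rfl⟩
      exact ⟨_, rfl⟩
    obtain ⟨x, hx⟩ := hz
    obtain ⟨w, hw, hw0⟩ := hR.exists_ker_add_closure_range x
    refine ⟨⟨w, (h.mem_X1_iff hβ).2 hw⟩, Subtype.ext ?_⟩
    have h1 := (exists_apply_resolvent (h.mem_resolventSet_add one_pos) (E (x - w)))
    have h2 : resolvent E A (((1 : ℝ) : ℂ) + α) (E (x - w)) = 0 := hw0
    obtain ⟨h3, h4⟩ := h1
    -- The resolvent is injective: if it sends `E (x - w)` to `0`, then `E (x - w) = 0`.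
    have h5 : A ⟨_, h3⟩ = 0 := by
      rw [← A.map_zero]; congr 1; exact Subtype.ext h2
    rw [h5, h2, map_zero, smul_zero, zero_sub, zero_eq_neg, map_sub, hx, sub_eq_zero] at h4
    exact h4.symm
  exact ⟨ContinuousLinearEquiv.ofBijective _ hker hsurj, rfl⟩

end IsRadialWith
end Pencil
end OperatorPencil

/-! ### Identification of the generator -/

theorem mainTheorem3 {X Z : Type*}
    [NormedAddCommGroup X] [InnerProductSpace ℂ X] [CompleteSpace X]
    [NormedAddCommGroup Z] [InnerProductSpace ℂ Z] [CompleteSpace Z]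
    (E : X →L[ℂ] Z) (A : X →ₗ.[ℂ] Z)
    (hA_dense : Dense (A.domain : Set X)) (hA_closed : A.IsClosed)
    (α K : ℝ)
    (h_radial : OperatorPencil.IsRadialWith E (OperatorPencil.shift E A (α : ℂ)) K)
    (h_range : IsClosed (Set.range E)) :
    (OperatorPencil.resolventSet E A).Nonempty ∧
    ∀ β ∈ OperatorPencil.resolventSet E A,
      (OperatorPencil.E1 E A β).IsInvertible ∧
      ∃ h : ∀ x : A.domain,
          (x : X) ∈ OperatorPencil.X1 E A β → A x ∈ OperatorPencil.Z1 E A β,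
        ∃ S : ℝ≥0 → OperatorPencil.X1 E A β →L[ℂ] OperatorPencil.X1 E A β,
          OperatorPencil.IsC0Semigroup S ∧
          OperatorPencil.IsGenerator
            (((OperatorPencil.E1 E A β).inverse :
                OperatorPencil.Z1 E A β →ₗ[ℂ] OperatorPencil.X1 E A β).compPMap
              (OperatorPencil.A1 E A β h)) S ∧
          ∀ t : ℝ≥0, ‖S t‖ ≤ K * Real.exp (α * t) := by
  have h1 := h_radial.mem_resolventSet_add one_pos
  refine ⟨⟨_, h1⟩, fun β hβ => ?_⟩
  have hE := h_radial.isInvertible_E1 hβ h_range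
  have : CompleteSpace (OperatorPencil.X1 E A β) :=
    (Submodule.isClosed_topologicalClosure _).completeSpace_coe
  obtain ⟨R, hR, hd, hcoe⟩ := h_radial.exists_isPseudoResolvent_restrict hβ
  obtain ⟨S, hS, hbound, hgen⟩ := hR.exists_semigroup_rescaled hd α
  refine ⟨hE, h_radial.apply_mem_Z1 hβ hA_closed, S, hS, fun y z => ?_, hbound⟩
  -- The generator condition becomes `y = ((1 + α)E - A)⁻¹((1 + α)E y - E z)`, which says that `y ∈
  -- D(A)` and `A y = E z`, that is, `z = E₁⁻¹ A₁ y`.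
  have hR1 : (R 1 (y - (z - (α : ℂ) • y)) : X) = OperatorPencil.resolvent E A (((1 : ℝ) : ℂ) + α)
      ((((1 : ℝ) : ℂ) + α) • E y - E z) := by
    rw [hcoe 1 one_pos]
    change OperatorPencil.resolvent E A _ (E (y - (z - (α : ℂ) • y))) = _
    congr 1
    simp only [map_sub, map_smul, Complex.ofReal_one]
    module
  rw [hgen, LinearPMap.mem_graph_iff, Subtype.ext_iff, hR1]
  constructor
  · rintro ⟨⟨y', hy⟩, hyy, hz⟩
    obtain rfl : y' = y := hyy
    have hA : A ⟨y', hy⟩ = E z := by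
      have h2 := congr(OperatorPencil.E1 E A β $hz)
      rw [LinearMap.compPMap_apply] at h2
      exact congrArg Subtype.val ((hE.self_apply_inverse _).symm.trans h2)
    rw [← hA]
    exact (OperatorPencil.resolvent_apply_sub h1 ⟨y', hy⟩).symm
  · intro hy
    obtain ⟨h2, h3⟩ := OperatorPencil.exists_apply_resolvent h1
      ((((1 : ℝ) : ℂ) + α) • E y - E z)
    have hmem : (y : X) ∈ A.domain := by rwa [hy]
    have hA : A ⟨y, hmem⟩ = E z := by
      have h4 : (⟨y, hmem⟩ : A.domain) = ⟨_, h2⟩ := Subtype.ext hy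
      rw [h4, h3, ← hy, sub_sub_cancel]
    refine ⟨⟨y, hmem⟩, rfl, ?_⟩
    rw [LinearMap.compPMap_apply]
    refine (congrArg _ (Subtype.ext hA)).trans (hE.inverse_apply_self z)
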